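/- **Setting.** All logarithms are natural. A density matrix $\rho$ of finitely many sites distributed among $k$ parties $A_1,\dots,A_k$ has the multipartite entanglement of purification $$E_p^{(k)}(A_1:\cdots:A_k)=\inf_{|\psi\rangle}\big[S_{A_1\tilde A_1}+\cdots+S_{A_k\tilde A_k}\big],$$ the infimum being over all purifications $|\psi\rangle_{A_1\tilde A_1\cdots A_k\tilde A_k}$ of $\rho$ with finite-dimensional purifying systems $\tilde A_1,\dots,\tilde A_k$; here $S$ is the von Neumann entropy. Write $H(\{p\}_\rho)$ for the Shannon entropy of the probability distribution given by the eigenvalues of $\rho$. For three parties put $$\Delta_p^{(3)}(A:B:C)=E_p^{(3)}(A:B:C)-\tfrac12\big[E_p^{(2)}(A:BC)+E_p^{(2)}(B:AC)+E_p^{(2)}(C:AB)\big],$$ and for four parties put $$\begin{aligned}\Delta_p^{(4)}(A:B:C:D)={}&E_p^{(4)}(A:B:C:D)\\&-\tfrac13\{E_p^{(3)}(AB:C:D)+E_p^{(3)}(AC:B:D)+E_p^{(3)}(AD:B:C)\\&\qquad+E_p^{(3)}(BC:A:D)+E_p^{(3)}(BD:A:C)+E_p^{(3)}(CD:A:B)\}\\&+\tfrac12\{E_p^{(2)}(A:BCD)+E_p^{(2)}(B:ACD)+E_p^{(2)}(C:ABD)+E_p^{(2)}(D:ABC)\}\\&-\tfrac16\{E_p^{(2)}(AB:CD)+E_p^{(2)}(AC:BD)+E_p^{(2)}(AD:BC)\}-H(\{p\}_{\rho_{ABCD}}).\end{aligned}$$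 The four-partite signal is considered for states satisfying the condition that $E_p^{(2)}(I:J)+E_p^{(2)}(K:L)\neq0$ for some arrangement $I,J,K,L$ of the four parties $A,B,C,D$, where $E_p^{(2)}(I:J)$ is that of the reduced state $\rho_{IJ}$. Let $|GHZ_n\rangle=\frac1{\sqrt2}(|0\rangle^{\otimes n}+|1\rangle^{\otimes n})$. **Statement.** Let $n\ge4$. 1. Let $A,B,C,D$ be nonempty, pairwise disjoint sets of the $n$ qubits and let $\rho_{ABCD}$ be the reduced density matrix of $|GHZ_n\rangle$ on $A\cup B\cup C\cup D$. Then the above condition holds, the infima defining $E_p^{(4)}$ and all the $E_p^{(3)}$ and $E_p^{(2)}$ in $\Delta^{(4)}_p(A:B:C:D)$ are minima, and $$\Delta_p^{(4)}(A:B:C:D)=E_p^{(4)}(A:B:C:D)-3\ln2-H(\{p\}_{\rho_{ABCD}}),$$ where $H(\{p\}_{\rho_{ABCD}})=0$ if $|A|+|B|+|C|+|D|=n$ and $H(\{p\}_{\rho_{ABCD}})=\ln2$ otherwise. Moreover $E_p^{(4)}(A:B:C:D)-3\ln2\ge0$ and $\Delta_p^{(4)}(A:B:C:D)\ge0$. 2.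 If $|A|+|B|+|C|+|D|=n$, so that $\rho_{ABCD}=|GHZ_n\rangle\langle GHZ_n|$ is pure, then $$\Delta_p^{(4)}(A:B:C:D)=E_p^{(4)}(A:B:C:D)-3\ln2=\ln2 .$$ In contrast, for every $n\ge3$ and every division of the $n$ qubits into nonempty parties $A,B,C$, the state $|GHZ_n\rangle\langle GHZ_n|$ has $\Delta_p^{(3)}(A:B:C)=0$. So $\Delta_p^{(4)}$, unlike $\Delta_p^{(3)}$, detects this GHZ entanglement. -/

import Mathlib

noncomputable section

namespace MultiEoP

/-- Computational basis of a finite register whose site `i` carries the Hilbert space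
`ℂ ^ (d i)`.  Vectors are functions `Config d → ℂ`, operators are matrices indexed by `Config d`. -/
abbrev Config {σ : Type} (d : σ → ℕ) : Type := ∀ i, Fin (d i)

/-- The reduced matrix on the sites in `s`: the partial trace over all sites outside `s`. -/
def reduced {σ : Type} [Fintype σ] [DecidableEq σ] {d : σ → ℕ} (s : Finset σ)
    (M : Matrix (Config d) (Config d) ℂ) :
    Matrix (Config fun i : {i // i ∈ s} => d i) (Config fun i : {i // i ∈ s} => d i) ℂ :=
  Matrix.of fun x y => ∑ z : (∀ i : {i // i ∉ s}, Fin (d i)),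
    M ((Equiv.piEquivPiSubtypeProd (· ∈ s) fun i => Fin (d i)).symm (x, z))
      ((Equiv.piEquivPiSubtypeProd (· ∈ s) fun i => Fin (d i)).symm (y, z))

/-- The matrix `|ψ⟩⟨ψ|`. -/
def ketBra {ι : Type} (ψ : ι → ℂ) : Matrix ι ι ℂ := Matrix.vecMulVec ψ (star ψ)

/-- The Shannon entropy (natural logarithm, `0 ln 0 = 0`) of a finite distribution. -/
def shannonEntropy {ι : Type} [Fintype ι] (p : ι → ℝ) : ℝ := ∑ i, Real.negMulLog (p i)

open Classical in
/-- The probability distribution of a density matrix: its eigenvalues, with multiplicity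
(zero for matrices that are not Hermitian; never used for those). -/
def eigenDistribution {ι : Type} [Fintype ι] [DecidableEq ι] (ρ : Matrix ι ι ℂ) : ι → ℝ :=
  if h : ρ.IsHermitian then h.eigenvalues else 0

/-- The von Neumann entropy `-Tr (ρ ln ρ)`, computed on the eigenvalues of `ρ`. -/
def vonNeumannEntropy {ι : Type} [Fintype ι] [DecidableEq ι] (ρ : Matrix ι ι ℂ) : ℝ :=
  ∑ i, Real.negMulLog (eigenDistribution ρ i)

section EoP

variable {σ κ : Type} [Fintype σ] [DecidableEq σ] [Fintype κ] [DecidableEq κ] {d : σ → ℕ}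

/-- `ψ` lives on the original sites `σ` together with one purifying system of dimension `m k`
for every party `k : κ`, and tracing out all the purifying systems gives `ρ`. -/
def IsPurification (ρ : Matrix (Config d) (Config d) ℂ) {m : κ → ℕ}
    (ψ : Config (Sum.elim d m) → ℂ) : Prop :=
  ∀ x y : Config d, ρ x y = ∑ z : Config m,
    ψ ((Equiv.sumPiEquivProdPi fun j => Fin (Sum.elim d m j)).symm (x, z)) *
      star (ψ ((Equiv.sumPiEquivProdPi fun j => Fin (Sum.elim d m j)).symm (y, z)))

/-- When the sites are distributed among the parties by `ℓ : σ → κ`, party `k` together with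
its purifying system. -/
def extendedParty (ℓ : σ → κ) (k : κ) : Finset (σ ⊕ κ) :=
  Finset.univ.filter fun j => Sum.elim ℓ id j = k

/-- The values of `∑ₖ S(Aₖ Ãₖ)` over all purifications of `ρ` with finite-dimensional
purifying systems `Ãₖ`, where party `Aₖ` holds the sites `i` with `ℓ i = k`. -/
def purificationEntropySums (ℓ : σ → κ) (ρ : Matrix (Config d) (Config d) ℂ) : Set ℝ :=
  {r | ∃ (m : κ → ℕ) (ψ : Config (Sum.elim d m) → ℂ), IsPurification ρ ψ ∧
    r = ∑ k, vonNeumannEntropy (reduced (extendedParty ℓ k) (ketBra ψ))}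

/-- The multipartite entanglement of purification of `ρ` with respect to the parties given by
`ℓ`.  Merging parties amounts to composing `ℓ` with a map of party labels. -/
def meop (ℓ : σ → κ) (ρ : Matrix (Config d) (Config d) ℂ) : ℝ :=
  sInf (purificationEntropySums ℓ ρ)

/-- The tripartite signal, with parties `A, B, C = 0, 1, 2`. -/
def delta3 (ℓ : σ → Fin 3) (ρ : Matrix (Config d) (Config d) ℂ) : ℝ :=
  meop ℓ ρ
    - 1 / 2 * (meop ((![0, 1, 1] : Fin 3 → Fin 2) ∘ ℓ) ρ
      + meop ((![1, 0, 1] : Fin 3 → Fin 2) ∘ ℓ) ρ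
      + meop ((![1, 1, 0] : Fin 3 → Fin 2) ∘ ℓ) ρ)

/-- The bipartite entanglement of purification of the two-party reduced state `ρ_{IJ}`. -/
def pairEoP (ℓ : σ → Fin 4) (ρ : Matrix (Config d) (Config d) ℂ) (I J : Fin 4) : ℝ :=
  meop (fun i : {i // i ∈ Finset.univ.filter fun i => ℓ i = I ∨ ℓ i = J} =>
      if ℓ i = I then (0 : Fin 2) else 1)
    (reduced (Finset.univ.filter fun i => ℓ i = I ∨ ℓ i = J) ρ)

/-- The condition under which the four-partite signal is considered. -/
def Delta4Condition (ℓ : σ → Fin 4) (ρ : Matrix (Config d) (Config d) ℂ) : Prop :=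
  ∃ I J K L : Fin 4, [I, J, K, L].Nodup ∧ pairEoP ℓ ρ I J + pairEoP ℓ ρ K L ≠ 0

/-- The four-partite signal, with parties `A, B, C, D = 0, 1, 2, 3`. -/
def delta4 (ℓ : σ → Fin 4) (ρ : Matrix (Config d) (Config d) ℂ) : ℝ :=
  meop ℓ ρ
    - 1 / 3 * (meop ((![0, 0, 1, 2] : Fin 4 → Fin 3) ∘ ℓ) ρ  -- AB : C : D
      + meop ((![0, 1, 0, 2] : Fin 4 → Fin 3) ∘ ℓ) ρ  -- AC : B : D
      + meop ((![0, 1, 2, 0] : Fin 4 → Fin 3) ∘ ℓ) ρ  -- AD : B : C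
      + meop ((![1, 0, 0, 2] : Fin 4 → Fin 3) ∘ ℓ) ρ  -- BC : A : D
      + meop ((![1, 0, 2, 0] : Fin 4 → Fin 3) ∘ ℓ) ρ  -- BD : A : C
      + meop ((![1, 2, 0, 0] : Fin 4 → Fin 3) ∘ ℓ) ρ)  -- CD : A : B
    + 1 / 2 * (meop ((![0, 1, 1, 1] : Fin 4 → Fin 2) ∘ ℓ) ρ  -- A : BCD
      + meop ((![1, 0, 1, 1] : Fin 4 → Fin 2) ∘ ℓ) ρ  -- B : ACD
      + meop ((![1, 1, 0, 1] : Fin 4 → Fin 2) ∘ ℓ) ρ  -- C : ABD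
      + meop ((![1, 1, 1, 0] : Fin 4 → Fin 2) ∘ ℓ) ρ)  -- D : ABC
    - 1 / 6 * (meop ((![0, 0, 1, 1] : Fin 4 → Fin 2) ∘ ℓ) ρ  -- AB : CD
      + meop ((![0, 1, 0, 1] : Fin 4 → Fin 2) ∘ ℓ) ρ  -- AC : BD
      + meop ((![0, 1, 1, 0] : Fin 4 → Fin 2) ∘ ℓ) ρ)  -- AD : BC
    - shannonEntropy (eigenDistribution ρ)

end EoP

/-- `|GHZ_n⟩ = (|0⟩^{⊗n} + |1⟩^{⊗n}) / √2`, a vector of the register of `n` qubits. -/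
def ghz (n : ℕ) : Config (fun _ : Fin n => 2) → ℂ :=
  ((1 / Real.sqrt 2 : ℝ) : ℂ) • (Pi.single (fun _ => 0) 1 + Pi.single (fun _ => 1) 1)

end MultiEoP

end

/-! Every `k`-party value occurring here equals `k * log 2`, for coherence `1/2` (pure GHZ) and `0`
(its proper reductions) alike.

Lower bound: a purification is supported where the original qubits are all 0 or all 1, each with
weight 1/2. A qubit of party `k` and a qubit of another party thus carry the same fair bit. This
makes the state of the extended party block diagonal with blocks of trace 1/2, so its eigenvalues
are at most 1/2 and its entropy is at least `log 2` (`log_two_le_vonNeumannEntropy_partialTrace`).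

Upper bound: in `ghzPurification` every extended party is an equal mixture of two orthogonal basis
states, with entropy exactly `log 2`.

Counting in units of `log 2`, before subtracting the Shannon entropy: the four-party signal is 4 -
18/3 + 8/2 - 6/6 = 1 and the three-party signal is 3 - 6/2 = 0. -/

noncomputable section

namespace MultiEoP

open scoped ComplexOrder

/-! ### Entropy from eigenvalue bounds -/

section Entropy

variable {ι : Type} [Fintype ι] [DecidableEq ι]

theorem vonNeumannEntropy_of_isHermitian {ρ : Matrix ι ι ℂ} (h : ρ.IsHermitian) :
    vonNeumannEntropy ρ = ∑ i, Real.negMulLog (h.eigenvalues i) := by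
  simp [vonNeumannEntropy, eigenDistribution, h]

theorem sum_eigenvalues_of_trace_one {ρ : Matrix ι ι ℂ} (h : ρ.IsHermitian)
    (htr : ρ.trace = 1) : ∑ i, h.eigenvalues i = 1 := by
  apply Complex.ofReal_injective
  rw [Complex.ofReal_one, ← htr, h.trace_eq_sum_eigenvalues, Complex.ofReal_sum]
  rfl

/-- A state all of whose eigenvalues are at most `c` has entropy at least `-ln c`. -/
theorem neg_log_le_vonNeumannEntropy {ρ : Matrix ι ι ℂ} (h : ρ.PosSemidef)
    (htr : ρ.trace = 1) {c : ℝ} (hle : ∀ i, h.isHermitian.eigenvalues i ≤ c) :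
    -Real.log c ≤ vonNeumannEntropy ρ := by
  rw [vonNeumannEntropy_of_isHermitian h.isHermitian]
  calc -Real.log c = ∑ i, h.isHermitian.eigenvalues i * -Real.log c := by
        rw [← Finset.sum_mul, sum_eigenvalues_of_trace_one h.isHermitian htr, one_mul]
    _ ≤ _ := by
        refine Finset.sum_le_sum fun i _ => ?_
        rcases (h.eigenvalues_nonneg i).eq_or_lt with h0 | h0
        · simp [← h0]
        · have := Real.log_le_log h0 (hle i)
          rw [Real.negMulLog]
          nlinarith

/-- A state proportional to a projection, `ρ² = c ρ`, has entropy `-ln c`. -/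
theorem vonNeumannEntropy_of_mul_self {ρ : Matrix ι ι ℂ} (h : ρ.IsHermitian)
    (htr : ρ.trace = 1) {c : ℝ} (hsq : ρ * ρ = (c : ℂ) • ρ) :
    vonNeumannEntropy ρ = -Real.log c := by
  -- Applying `ρ² = c ρ` to an eigenvector gives `λ² = c λ`, so `λ` is 0 or `c`.
  have key : ∀ i, Real.negMulLog (h.eigenvalues i) = h.eigenvalues i * -Real.log c := by
    intro i
    have hv := h.mulVec_eigenvectorBasis i
    have hv0 : (h.eigenvectorBasis i : ι → ℂ) ≠ 0 := by
      intro h0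
      exact h.eigenvectorBasis.toBasis.ne_zero i (by ext j; simpa using congrFun h0 j)
    have h2 : ρ.mulVec (ρ.mulVec (h.eigenvectorBasis i : ι → ℂ)) =
        (c : ℂ) • ρ.mulVec (h.eigenvectorBasis i : ι → ℂ) := by
      rw [Matrix.mulVec_mulVec, hsq, Matrix.smul_mulVec]
    obtain ⟨j, hj⟩ := Function.ne_iff.mp hv0
    rw [hv, Matrix.mulVec_smul, hv] at h2
    have h3 := congrFun h2 j
    simp only [Pi.smul_apply, Complex.real_smul, smul_eq_mul, ← mul_assoc] at h3
    have h4 := mul_right_cancel₀ hj h3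
    have h5 : h.eigenvalues i * h.eigenvalues i = c * h.eigenvalues i := by exact_mod_cast h4
    rcases eq_or_ne (h.eigenvalues i) 0 with h0 | h0
    · simp [h0]
    · rw [Real.negMulLog, mul_right_cancel₀ h0 h5]; ring
  rw [vonNeumannEntropy_of_isHermitian h, Finset.sum_congr rfl fun i _ => key i,
    ← Finset.sum_mul, sum_eigenvalues_of_trace_one h htr, one_mul]

end Entropy

/-! ### Partial traces as Gram matrices of amplitudes -/

section PartialTrace

variable {X P Q : Type} [Fintype Q]

/-- The partial trace over `Q` for a register whose basis splits as `X ≃ P × Q`. -/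
def partialTrace (e : X ≃ P × Q) (M : Matrix X X ℂ) : Matrix P P ℂ :=
  Matrix.of fun x y => ∑ z, M (e.symm (x, z)) (e.symm (y, z))

/-- The amplitudes of a vector as a matrix from the traced-out factor to the remaining one. -/
def amplitudes (e : X ≃ P × Q) (ψ : X → ℂ) : Matrix P Q ℂ :=
  Matrix.of fun x z => ψ (e.symm (x, z))

theorem partialTrace_ketBra (e : X ≃ P × Q) (ψ : X → ℂ) :
    partialTrace e (ketBra ψ) = amplitudes e ψ * (amplitudes e ψ).conjTranspose := by
  ext x y
  simp [partialTrace, amplitudes, ketBra, Matrix.vecMulVec, Matrix.mul_apply]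

theorem trace_partialTrace_ketBra [Fintype P] [Fintype X] (e : X ≃ P × Q) (ψ : X → ℂ) :
    (partialTrace e (ketBra ψ)).trace = ((∑ x, ‖ψ x‖ ^ 2 : ℝ) : ℂ) := by
  rw [← e.symm.sum_comp, Fintype.sum_prod_type]
  simp [Matrix.trace, partialTrace, ketBra, Matrix.vecMulVec, Complex.mul_conj,
    Complex.normSq_eq_norm_sq]

end PartialTrace

/-! ### Entropy bound from a bit shared by both factors -/

section Flag

variable {W U T : Type} [Fintype W] [Fintype U] [Fintype T] [DecidableEq T]

/-- If `F w u` vanishes unless the flags of `w` and `u` agree and each flag carries weight at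
most `c`, then `F Fᴴ` is bounded by `c`. -/
theorem sum_norm_conjTranspose_mulVec_le (F : Matrix W U ℂ) (f : W → T) (g : U → T)
    (hF : ∀ w u, F w u ≠ 0 → f w = g u) {c : ℝ}
    (hc : ∀ t, (∑ u, if g u = t then ∑ w, ‖F w u‖ ^ 2 else 0) ≤ c) (v : W → ℂ) :
    ∑ u, ‖(F.conjTranspose.mulVec v) u‖ ^ 2 ≤ c * ∑ w, ‖v w‖ ^ 2 := by
  -- `N t` is the weight of `v` in the sector with flag `t`. Column `u` of `F` sees only the sector
  -- `g u`, so Cauchy–Schwarz bounds its contribution by that weight alone.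
  set N : T → ℝ := fun t => ∑ w, if f w = t then ‖v w‖ ^ 2 else 0 with hN
  have hN0 : ∀ t, 0 ≤ N t := fun t => Finset.sum_nonneg fun w _ => by split_ifs <;> positivity
  have hsum : ∑ t, N t = ∑ w, ‖v w‖ ^ 2 := by
    rw [hN, Finset.sum_comm]; simp
  have hpt : ∀ u, ‖(F.conjTranspose.mulVec v) u‖ ^ 2 ≤ N (g u) * ∑ w, ‖F w u‖ ^ 2 := by
    intro u
    have h1 : ‖(F.conjTranspose.mulVec v) u‖ ≤
        ∑ w, (if f w = g u then ‖v w‖ else 0) * ‖F w u‖ := by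
      refine (norm_sum_le _ _).trans (Finset.sum_le_sum fun w _ => ?_)
      by_cases h : f w = g u
      · simp [h, mul_comm]
      · have : F w u = 0 := by by_contra h'; exact h (hF w u h')
        simp [h, this]
    calc _ ≤ (∑ w, (if f w = g u then ‖v w‖ else 0) * ‖F w u‖) ^ 2 := by gcongr
      _ ≤ (∑ w, (if f w = g u then ‖v w‖ else 0) ^ 2) * ∑ w, ‖F w u‖ ^ 2 :=
        Finset.sum_mul_sq_le_sq_mul_sq _ _ _
      _ = _ := by simp [hN, ite_pow]
  calc _ ≤ ∑ u, N (g u) * ∑ w, ‖F w u‖ ^ 2 := Finset.sum_le_sum fun u _ => hpt u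
    _ = ∑ t, N t * ∑ u, (if g u = t then ∑ w, ‖F w u‖ ^ 2 else 0) := by
        simp only [Finset.mul_sum (s := (Finset.univ : Finset U)), mul_ite, mul_zero]
        rw [Finset.sum_comm]
        simp
    _ ≤ ∑ t, N t * c := Finset.sum_le_sum fun t _ => mul_le_mul_of_nonneg_left (hc t) (hN0 t)
    _ = _ := by rw [← Finset.sum_mul, hsum, mul_comm]

/-- At a unit eigenvector `v` the eigenvalue of `F Fᴴ` is `‖Fᴴ v‖²`, which the preceding estimate
controls. -/
theorem eigenvalues_mul_conjTranspose_le [DecidableEq W] (F : Matrix W U ℂ) (f : W → T)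
    (g : U → T) (hF : ∀ w u, F w u ≠ 0 → f w = g u) {c : ℝ}
    (hc : ∀ t, (∑ u, if g u = t then ∑ w, ‖F w u‖ ^ 2 else 0) ≤ c)
    (h : (F * F.conjTranspose).IsHermitian) (i : W) : h.eigenvalues i ≤ c := by
  have hb := sum_norm_conjTranspose_mulVec_le F f g hF hc (h.eigenvectorBasis i)
  have h1 : ∑ w, ‖h.eigenvectorBasis i w‖ ^ 2 = 1 := by
    rw [← EuclideanSpace.norm_sq_eq, h.eigenvectorBasis.orthonormal.1 i, one_pow]
  rw [h1, mul_one] at hb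
  refine le_trans (le_of_eq ?_) hb
  have h2 : ∀ v : W → ℂ, Matrix.vecMul (star v) F = star (F.conjTranspose.mulVec v) := fun v => by
    rw [Matrix.star_mulVec, F.conjTranspose_conjTranspose]
  rw [h.eigenvalues_eq, ← Matrix.mulVec_mulVec, Matrix.dotProduct_mulVec, h2]
  simp [dotProduct, Complex.conj_mul', ← Complex.ofReal_pow]

/-- If a flag with two equally likely values is shared between the two factors, the reduced state
has entropy at least `ln 2`. -/
theorem log_two_le_vonNeumannEntropy_partialTrace {X : Type} [Fintype X] [DecidableEq W]
    (e : X ≃ W × U) (ψ : X → ℂ) (f : W → Fin 2) (g : U → Fin 2)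
    (hψ : ∀ x, ψ x ≠ 0 → f (e x).1 = g (e x).2)
    (hw : ∀ t, (∑ x, if g (e x).2 = t then ‖ψ x‖ ^ 2 else 0) = 1 / 2) :
    Real.log 2 ≤ vonNeumannEntropy (partialTrace e (ketBra ψ)) := by
  have htot : ∑ x, ‖ψ x‖ ^ 2 = 1 := by
    have h2 := Finset.sum_comm (s := Finset.univ) (t := Finset.univ)
      (f := fun (t : Fin 2) x => if g (e x).2 = t then ‖ψ x‖ ^ 2 else 0)
    simp only [hw, Finset.sum_ite_eq, Finset.mem_univ, if_true] at h2
    rw [← h2]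
    norm_num
  have htr : (partialTrace e (ketBra ψ)).trace = 1 := by
    rw [trace_partialTrace_ketBra, htot, Complex.ofReal_one]
  rw [partialTrace_ketBra] at htr ⊢
  have hpsd := Matrix.posSemidef_self_mul_conjTranspose (amplitudes e ψ)
  have := neg_log_le_vonNeumannEntropy hpsd htr (c := 1 / 2)
    (eigenvalues_mul_conjTranspose_le (amplitudes e ψ) f g ?_ ?_ hpsd.isHermitian)
  · simpa using this
  · intro w u hwu
    simpa using hψ _ hwu
  · intro t
    rw [← hw t, ← e.symm.sum_comp, Fintype.sum_prod_type, Finset.sum_comm]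
    refine Finset.sum_le_sum fun u _ => ?_
    split_ifs with h <;> simp [h, amplitudes]

end Flag

/-! ### Two-term superpositions and their purifications -/

section Cat

variable {X : Type} [DecidableEq X]

/-- The mixed or pure superposition of two basis states `a` and `b` with coherence `c`. -/
def catMatrix (a b : X) (c : ℂ) : Matrix X X ℂ :=
  (1 / 2 : ℂ) • (Matrix.single a a 1 + Matrix.single b b 1) +
    c • (Matrix.single a b 1 + Matrix.single b a 1)

/-- The vector `(|a⟩ + |b⟩) / √2`. -/
def catVector (a b : X) : X → ℂ :=
  ((1 / Real.sqrt 2 : ℝ) : ℂ) • (Pi.single a 1 + Pi.single b 1)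

theorem ketBra_catVector (a b : X) : ketBra (catVector a b) = catMatrix a b (1 / 2) := by
  have h : ((1 / Real.sqrt 2 : ℝ) : ℂ) * ((1 / Real.sqrt 2 : ℝ) : ℂ) = 1 / 2 := by
    rw [← Complex.ofReal_mul, div_mul_div_comm, Real.mul_self_sqrt (by norm_num)]; norm_num
  have hs : ∀ a b x y : X, Matrix.single a b (1 : ℂ) x y =
      (if x = a then 1 else 0) * if y = b then 1 else 0 := by
    intro a b x y
    simp only [Matrix.single_apply, @eq_comm _ a, @eq_comm _ b]
    split_ifs <;> simp_all
  ext x y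
  simp only [ketBra, catVector, catMatrix, Matrix.vecMulVec_apply, Pi.smul_apply, Pi.add_apply,
    Pi.star_apply, Pi.single_apply, Matrix.add_apply, Matrix.smul_apply, hs, smul_eq_mul,
    star_mul', star_add, apply_ite star, star_one, star_zero, Complex.star_def,
    Complex.conj_ofReal]
  linear_combination ((if x = a then 1 else 0) + if x = b then 1 else 0) *
    ((if y = a then 1 else 0) + if y = b then 1 else 0) * h

theorem catMatrix_isHermitian (a b : X) {c : ℂ} (hc : star c = c) :
    (catMatrix a b c).IsHermitian := by
  simp [Matrix.IsHermitian, catMatrix, Matrix.conjTranspose_add,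
    Matrix.conjTranspose_single, hc, add_comm (Matrix.single b a c)]

theorem trace_catMatrix [Fintype X] {a b : X} (hab : a ≠ b) (c : ℂ) :
    (catMatrix a b c).trace = 1 := by
  simp [catMatrix, Matrix.trace_add, hab, hab.symm]
  norm_num

theorem vonNeumannEntropy_catMatrix_zero [Fintype X] {a b : X} (hab : a ≠ b) :
    vonNeumannEntropy (catMatrix a b 0) = Real.log 2 := by
  rw [vonNeumannEntropy_of_mul_self (c := 1 / 2) (catMatrix_isHermitian a b (by simp))
    (trace_catMatrix hab 0)]
  · simp
  · simp [catMatrix, mul_add, add_mul, hab, hab.symm]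

theorem vonNeumannEntropy_catMatrix_half [Fintype X] {a b : X} (hab : a ≠ b) :
    vonNeumannEntropy (catMatrix a b (1 / 2)) = 0 := by
  rw [vonNeumannEntropy_of_mul_self (c := 1) (catMatrix_isHermitian a b (by simp))
    (trace_catMatrix hab _)]
  · simp
  · simp [catMatrix, mul_add, add_mul, hab, hab.symm]
    -- Squaring produces each entry as two products 1/2 · 1/2; splitting 1/2 the same way lets the
    -- terms cancel.
    have h : ∀ x y : X, Matrix.single x y (2⁻¹ : ℂ) =
        Matrix.single x y (2⁻¹ * 2⁻¹) + Matrix.single x y (2⁻¹ * 2⁻¹) := fun x y => by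
      rw [← Matrix.single_add]; norm_num
    simp only [h]
    abel

/-- The cross terms survive exactly when `a` and `b` agree on the traced-out factor; otherwise that
factor records which branch occurred. -/
theorem partialTrace_catMatrix {P Q : Type} [Fintype Q] [DecidableEq P] [DecidableEq Q]
    (e : X ≃ P × Q) (a b : X) (c : ℂ) :
    partialTrace e (catMatrix a b c) =
      catMatrix (e a).1 (e b).1 (if (e a).2 = (e b).2 then c else 0) := by
  have key : ∀ a b : X, ∀ x y, ∑ z, (Matrix.single a b (1 : ℂ)) (e.symm (x, z)) (e.symm (y, z)) =
      if (e a).2 = (e b).2 then Matrix.single (e a).1 (e b).1 (1 : ℂ) x y else 0 := by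
    intro a b x y
    have : ∀ z, Matrix.single a b (1 : ℂ) (e.symm (x, z)) (e.symm (y, z)) =
        if z = (e a).2 then (if (e a).2 = (e b).2 then
          Matrix.single (e a).1 (e b).1 (1 : ℂ) x y else 0) else 0 := by
      intro z
      simp only [Matrix.single_apply, Equiv.eq_symm_apply, Prod.ext_iff]
      grind
    simp [this]
  ext x y
  simp only [partialTrace, catMatrix, Matrix.of_apply, Matrix.add_apply, Matrix.smul_apply,
    Finset.sum_add_distrib, ← Finset.smul_sum, key]
  split_ifs with h1 h2 h2 <;> simp_all

theorem catMatrix_apply_self {a b : X} (hab : a ≠ b) (c : ℂ) (x : X) :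
    catMatrix a b c x x = ((if x = a ∨ x = b then 1 / 2 else 0 : ℝ) : ℂ) := by
  simp only [catMatrix, Matrix.add_apply, Matrix.smul_apply, Matrix.single_apply]
  split_ifs <;> simp <;> grind

variable {P Q : Type} [Fintype Q] [DecidableEq P] {e : X ≃ P × Q} {a b : P} {c : ℂ} {ψ : X → ℂ}

omit [DecidableEq X] in
-- Only the diagonal of the reduced state is used, hence no condition on `c`.
theorem sum_norm_sq_of_partialTrace_eq (hab : a ≠ b)
    (h : catMatrix a b c = partialTrace e (ketBra ψ)) (x : P) :
    ∑ z, ‖ψ (e.symm (x, z))‖ ^ 2 = if x = a ∨ x = b then 1 / 2 else 0 := by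
  have h1 := congrFun (congrFun h x) x
  rw [catMatrix_apply_self hab] at h1
  apply Complex.ofReal_injective
  rw [h1]
  simp [partialTrace, ketBra, Matrix.vecMulVec, Complex.mul_conj, Complex.normSq_eq_norm_sq]

omit [DecidableEq X] in
theorem eq_or_eq_of_partialTrace_eq (hab : a ≠ b)
    (h : catMatrix a b c = partialTrace e (ketBra ψ)) {y : X} (hy : ψ y ≠ 0) :
    (e y).1 = a ∨ (e y).1 = b := by
  have h0 : 0 < ∑ z, ‖ψ (e.symm ((e y).1, z))‖ ^ 2 :=
    Finset.sum_pos' (fun _ _ => by positivity) ⟨(e y).2, Finset.mem_univ _, by simp; positivity⟩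
  rw [sum_norm_sq_of_partialTrace_eq hab h] at h0
  by_contra hne
  simp [hne] at h0

omit [DecidableEq X] in
theorem sum_ite_norm_sq_of_partialTrace_eq [Fintype X] [Fintype P] (hab : a ≠ b)
    (h : catMatrix a b c = partialTrace e (ketBra ψ)) (p : P → Prop) [DecidablePred p] :
    (∑ y, if p (e y).1 then ‖ψ y‖ ^ 2 else 0) =
      (if p a then 1 / 2 else 0) + if p b then 1 / 2 else 0 := by
  rw [← e.symm.sum_comp, Fintype.sum_prod_type]
  have h1 : ∀ x, (∑ z, if p (e (e.symm (x, z))).1 then ‖ψ (e.symm (x, z))‖ ^ 2 else 0) =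
      (if x = a then (if p a then 1 / 2 else 0) else 0) +
        if x = b then (if p b then 1 / 2 else 0) else 0 := by
    intro x
    simp only [Equiv.apply_symm_apply]
    by_cases hp : p x
    · simp only [hp, if_true, sum_norm_sq_of_partialTrace_eq hab h]
      grind
    · simp only [hp, if_false, Finset.sum_const_zero]
      grind
  rw [Finset.sum_congr rfl fun x _ => h1 x, Finset.sum_add_distrib]
  simp

end Cat

/-! ### GHZ states distributed among parties -/

section Parties

variable {σ κ : Type} [Fintype σ] [DecidableEq σ] [Fintype κ] [DecidableEq κ] {d : σ → ℕ}

theorem reduced_eq_partialTrace (s : Finset σ) (M : Matrix (Config d) (Config d) ℂ) :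
    reduced s M =
      partialTrace (Equiv.piEquivPiSubtypeProd (· ∈ s) fun i => Fin (d i)) M := rfl

omit [Fintype σ] [DecidableEq σ] in
theorem isPurification_iff (ρ : Matrix (Config d) (Config d) ℂ) {m : κ → ℕ}
    (ψ : Config (Sum.elim d m) → ℂ) :
    IsPurification ρ ψ ↔
      ρ = partialTrace (Equiv.sumPiEquivProdPi fun j => Fin (Sum.elim d m j)) (ketBra ψ) :=
  ⟨fun h => Matrix.ext h, fun h x y => congrFun (congrFun h x) y⟩

/-- The reduced density matrix of a GHZ state of the qubits `σ` (`c = 1/2`), or of a GHZ state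
of more qubits (`c = 0`). -/
def ghzMatrix (σ : Type) [Fintype σ] [DecidableEq σ] (c : ℂ) :
    Matrix (Config fun _ : σ => 2) (Config fun _ : σ => 2) ℂ :=
  catMatrix (fun _ => 0) (fun _ => 1) c

omit [Fintype σ] [DecidableEq σ] in
theorem const_zero_ne_const_one [Nonempty σ] :
    (fun _ => 0 : Config fun _ : σ => 2) ≠ fun _ => 1 := fun h => by
  simpa using congrFun h (Classical.arbitrary σ)

theorem ketBra_ghz (n : ℕ) : ketBra (ghz n) = ghzMatrix (Fin n) (1 / 2) :=
  ketBra_catVector _ _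

theorem reduced_ghzMatrix_univ (c : ℂ) :
    reduced Finset.univ (ghzMatrix σ c) = ghzMatrix {i // i ∈ (Finset.univ : Finset σ)} c := by
  rw [reduced_eq_partialTrace, ghzMatrix, partialTrace_catMatrix, if_pos]
  · rfl
  · ext i; exact absurd (Finset.mem_univ _) i.2

theorem reduced_ghzMatrix {s : Finset σ} (hs : s ≠ Finset.univ) (c : ℂ) :
    reduced s (ghzMatrix σ c) = ghzMatrix {i // i ∈ s} 0 := by
  rw [reduced_eq_partialTrace, ghzMatrix, partialTrace_catMatrix, if_neg]
  · rfl
  · obtain ⟨i, hi⟩ : ∃ i, i ∉ s := by simpa [Finset.eq_univ_iff_forall] using hs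
    intro h
    simpa using congrFun h ⟨i, hi⟩

omit [DecidableEq σ] in
theorem mem_extendedParty {ℓ : σ → κ} {k : κ} {j : σ ⊕ κ} :
    j ∈ extendedParty ℓ k ↔ Sum.elim ℓ id j = k := by simp [extendedParty]

/-- In every purification of a GHZ-type state, the entropy of every party together with its
purifying system is at least `ln 2`. -/
theorem log_two_le_vonNeumannEntropy_reduced [Nontrivial κ] {ℓ : σ → κ}
    (hℓ : Function.Surjective ℓ) {c : ℂ} {m : κ → ℕ}
    {ψ : Config (Sum.elim (fun _ : σ => 2) m) → ℂ} (h : IsPurification (ghzMatrix σ c) ψ) (k : κ) :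
    Real.log 2 ≤ vonNeumannEntropy (reduced (extendedParty ℓ k) (ketBra ψ)) := by
  obtain ⟨i, hi⟩ := hℓ k
  obtain ⟨k', hk'⟩ := exists_ne k
  obtain ⟨j, hj⟩ := hℓ k'
  have : Nonempty σ := ⟨i⟩
  have his : (Sum.inl i : σ ⊕ κ) ∈ extendedParty ℓ k := mem_extendedParty.2 hi
  have hjs : (Sum.inl j : σ ⊕ κ) ∉ extendedParty ℓ k := fun h' =>
    hk' (hj.symm.trans (mem_extendedParty.1 h'))
  rw [isPurification_iff] at h
  -- The shared flag is read off at qubit `i` inside the extended party and at qubit `j` outside it.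
  refine log_two_le_vonNeumannEntropy_partialTrace _ ψ (fun w => w ⟨Sum.inl i, his⟩)
    (fun u => u ⟨Sum.inl j, hjs⟩) ?_ ?_
  · intro y hy
    have h1 := eq_or_eq_of_partialTrace_eq const_zero_ne_const_one h hy
    rcases h1 with h1 | h1 <;> exact (congrFun h1 i).trans (congrFun h1 j).symm
  · intro t
    refine (sum_ite_norm_sq_of_partialTrace_eq const_zero_ne_const_one h
      (fun x => x j = t)).trans ?_
    fin_cases t <;> simp

/-- The purification `(|0…0⟩|0…0⟩ + |1…1⟩|t…t⟩) / √2`. -/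
def ghzPurification (σ κ : Type) [Fintype σ] [DecidableEq σ] [Fintype κ] [DecidableEq κ]
    (t : Fin 2) : Config (Sum.elim (fun _ : σ => 2) fun _ : κ => 2) → ℂ :=
  catVector ((Equiv.sumPiEquivProdPi _).symm (fun _ => (0 : Fin 2), fun _ => (0 : Fin 2)))
    ((Equiv.sumPiEquivProdPi _).symm (fun _ => (1 : Fin 2), fun _ => t))

theorem isPurification_ghzPurification [Nonempty κ] (t : Fin 2) :
    IsPurification (ghzMatrix σ (if t = 0 then 1 / 2 else 0)) (ghzPurification σ κ t) := by
  rw [isPurification_iff, ghzPurification, ketBra_catVector, partialTrace_catMatrix]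
  simp only [Equiv.apply_symm_apply, ghzMatrix]
  congr 1
  -- The purifying registers agree in both branches iff `t = 0`; the converse needs at least one
  -- register, hence `Nonempty κ`.
  refine if_congr ⟨fun h => by rw [h]; rfl, fun h => ?_⟩ rfl rfl
  exact (congrFun h (Classical.arbitrary κ)).symm

theorem vonNeumannEntropy_reduced_ghzPurification [Nontrivial κ] {ℓ : σ → κ}
    (hℓ : Function.Surjective ℓ) (t : Fin 2) (k : κ) :
    vonNeumannEntropy (reduced (extendedParty ℓ k) (ketBra (ghzPurification σ κ t))) =
      Real.log 2 := by
  obtain ⟨i, hi⟩ := hℓ k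
  obtain ⟨k', hk'⟩ := exists_ne k
  obtain ⟨j, hj⟩ := hℓ k'
  have his : (Sum.inl i : σ ⊕ κ) ∈ extendedParty ℓ k := mem_extendedParty.2 hi
  have hjs : (Sum.inl j : σ ⊕ κ) ∉ extendedParty ℓ k := fun h' =>
    hk' (hj.symm.trans (mem_extendedParty.1 h'))
  -- Qubit `j`, traced out, destroys the coherence; qubit `i`, kept, makes the two remaining
  -- branches orthogonal.
  rw [reduced_eq_partialTrace, ghzPurification, ketBra_catVector, partialTrace_catMatrix, if_neg]
  · refine vonNeumannEntropy_catMatrix_zero fun h => ?_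
    exact zero_ne_one (α := Fin 2) (congrFun h ⟨Sum.inl i, his⟩)
  · intro h
    exact zero_ne_one (α := Fin 2) (congrFun h ⟨Sum.inl j, hjs⟩)

theorem isLeast_purificationEntropySums_ghzMatrix [Nontrivial κ] {ℓ : σ → κ}
    (hℓ : Function.Surjective ℓ) {c : ℂ} (hc : c = 1 / 2 ∨ c = 0) :
    IsLeast (purificationEntropySums ℓ (ghzMatrix σ c)) (Fintype.card κ * Real.log 2) := by
  constructor
  · obtain ⟨t, rfl⟩ : ∃ t : Fin 2, c = if t = 0 then 1 / 2 else 0 := by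
      rcases hc with rfl | rfl
      exacts [⟨0, by simp⟩, ⟨1, by simp⟩]
    refine ⟨_, ghzPurification σ κ t, isPurification_ghzPurification t, ?_⟩
    simp [vonNeumannEntropy_reduced_ghzPurification hℓ]
  · rintro r ⟨m, ψ, hψ, rfl⟩
    calc (Fintype.card κ * Real.log 2 : ℝ) = ∑ _k : κ, Real.log 2 := by simp
      _ ≤ _ := Finset.sum_le_sum fun k _ => log_two_le_vonNeumannEntropy_reduced hℓ hψ k

theorem meop_ghzMatrix [Nontrivial κ] {ℓ : σ → κ}
    (hℓ : Function.Surjective ℓ) {c : ℂ} (hc : c = 1 / 2 ∨ c = 0) :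
    meop ℓ (ghzMatrix σ c) = Fintype.card κ * Real.log 2 :=
  (isLeast_purificationEntropySums_ghzMatrix hℓ hc).csInf_eq

theorem isLeast_meop_ghzMatrix [Nontrivial κ] {ℓ : σ → κ}
    (hℓ : Function.Surjective ℓ) {c : ℂ} (hc : c = 1 / 2 ∨ c = 0) :
    IsLeast (purificationEntropySums ℓ (ghzMatrix σ c)) (meop ℓ (ghzMatrix σ c)) := by
  rw [meop_ghzMatrix hℓ hc]
  exact isLeast_purificationEntropySums_ghzMatrix hℓ hc

/-- The third party `K` is traced out, so the pair is left with coherence 0 whatever `c` is. -/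
theorem pairEoP_ghzMatrix {ℓ : σ → Fin 4} (hℓ : Function.Surjective ℓ) (c : ℂ) {I J K : Fin 4}
    (hIJ : I ≠ J) (hIK : K ≠ I) (hJK : K ≠ J) :
    pairEoP ℓ (ghzMatrix σ c) I J = 2 * Real.log 2 := by
  obtain ⟨i, hi⟩ := hℓ I
  obtain ⟨j, hj⟩ := hℓ J
  obtain ⟨k, hk⟩ := hℓ K
  rw [pairEoP, reduced_ghzMatrix, meop_ghzMatrix _ (Or.inr rfl)]
  · simp
  · intro t
    fin_cases t
    · exact ⟨⟨i, by simp [hi]⟩, by simp [hi]⟩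
    · exact ⟨⟨j, by simp [hj]⟩, by simp [hj, hIJ.symm]⟩
  · intro h
    have := h ▸ Finset.mem_univ k
    simp [hk, hIK, hJK] at this

theorem delta4Condition_ghzMatrix {ℓ : σ → Fin 4} (hℓ : Function.Surjective ℓ) (c : ℂ) :
    Delta4Condition ℓ (ghzMatrix σ c) := by
  refine ⟨0, 1, 2, 3, by decide, ?_⟩
  rw [pairEoP_ghzMatrix hℓ c (K := 2) (by decide) (by decide) (by decide),
    pairEoP_ghzMatrix hℓ c (K := 0) (by decide) (by decide) (by decide)]
  have := Real.log_pos one_lt_two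
  positivity

theorem delta4_ghzMatrix {ℓ : σ → Fin 4} (hℓ : Function.Surjective ℓ) {c : ℂ}
    (hc : c = 1 / 2 ∨ c = 0) :
    delta4 ℓ (ghzMatrix σ c) =
      Real.log 2 - shannonEntropy (eigenDistribution (ghzMatrix σ c)) := by
  have h : ∀ {k : ℕ} [Nontrivial (Fin k)] {g : Fin 4 → Fin k}, Function.Surjective g →
      meop (g ∘ ℓ) (ghzMatrix σ c) = k * Real.log 2 := fun hg => by
    simpa using meop_ghzMatrix (hg.comp hℓ) hc
  have h4 : meop ℓ (ghzMatrix σ c) = 4 * Real.log 2 := by simpa using meop_ghzMatrix hℓ hc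
  rw [delta4, h4]
  repeat rw [h (by decide)]
  push_cast
  ring

theorem delta3_ghzMatrix {ℓ : σ → Fin 3} (hℓ : Function.Surjective ℓ) {c : ℂ}
    (hc : c = 1 / 2 ∨ c = 0) : delta3 ℓ (ghzMatrix σ c) = 0 := by
  have h : ∀ {g : Fin 3 → Fin 2}, Function.Surjective g →
      meop (g ∘ ℓ) (ghzMatrix σ c) = 2 * Real.log 2 := fun hg => by
    simpa using meop_ghzMatrix (hg.comp hℓ) hc
  have h3 : meop ℓ (ghzMatrix σ c) = 3 * Real.log 2 := by simpa using meop_ghzMatrix hℓ hc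
  rw [delta3, h3]
  repeat rw [h (by decide)]
  ring

theorem shannonEntropy_ghzMatrix_half [Nonempty σ] :
    shannonEntropy (eigenDistribution (ghzMatrix σ (1 / 2))) = 0 :=
  vonNeumannEntropy_catMatrix_half const_zero_ne_const_one

theorem shannonEntropy_ghzMatrix_zero [Nonempty σ] :
    shannonEntropy (eigenDistribution (ghzMatrix σ 0)) = Real.log 2 :=
  vonNeumannEntropy_catMatrix_zero const_zero_ne_const_one

end Parties

end MultiEoP

end

/-! ### The signals of GHZ states -/

theorem mainTheorem5 (n : ℕ) :
    (4 ≤ n →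
      -- four nonempty disjoint parties made up of the qubits in `S`, the others traced out
      (∀ (S : Finset (Fin n)) (ℓ : {i // i ∈ S} → Fin 4), Function.Surjective ℓ →
        ∀ ρ, ρ = MultiEoP.reduced S (MultiEoP.ketBra (MultiEoP.ghz n)) →
          MultiEoP.Delta4Condition ℓ ρ ∧
          (∀ (k : ℕ) (g : Fin 4 → Fin k), 2 ≤ k → Function.Surjective g →
            IsLeast (MultiEoP.purificationEntropySums (g ∘ ℓ) ρ) (MultiEoP.meop (g ∘ ℓ) ρ)) ∧
          MultiEoP.delta4 ℓ ρ = MultiEoP.meop ℓ ρ - 3 * Real.log 2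
            - MultiEoP.shannonEntropy (MultiEoP.eigenDistribution ρ) ∧
          (S = Finset.univ → MultiEoP.shannonEntropy (MultiEoP.eigenDistribution ρ) = 0) ∧
          (S ≠ Finset.univ →
            MultiEoP.shannonEntropy (MultiEoP.eigenDistribution ρ) = Real.log 2) ∧
          0 ≤ MultiEoP.meop ℓ ρ - 3 * Real.log 2 ∧
          0 ≤ MultiEoP.delta4 ℓ ρ) ∧
      -- all `n` qubits are distributed among the four parties
      (∀ ℓ : Fin n → Fin 4, Function.Surjective ℓ →
        ∀ ρ, ρ = MultiEoP.ketBra (MultiEoP.ghz n) →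
          MultiEoP.Delta4Condition ℓ ρ ∧
          (∀ (k : ℕ) (g : Fin 4 → Fin k), 2 ≤ k → Function.Surjective g →
            IsLeast (MultiEoP.purificationEntropySums (g ∘ ℓ) ρ) (MultiEoP.meop (g ∘ ℓ) ρ)) ∧
          MultiEoP.delta4 ℓ ρ = MultiEoP.meop ℓ ρ - 3 * Real.log 2 ∧
          MultiEoP.delta4 ℓ ρ = Real.log 2)) ∧
    -- the tripartite signal vanishes on all GHZ states
    (3 ≤ n → ∀ ℓ : Fin n → Fin 3, Function.Surjective ℓ →
      MultiEoP.delta3 ℓ (MultiEoP.ketBra (MultiEoP.ghz n)) = 0) := by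
  have hlog := Real.log_pos one_lt_two
  refine ⟨fun _ => ⟨?_, ?_⟩, ?_⟩
  · rintro S ℓ hℓ ρ rfl
    have : Nonempty {i // i ∈ S} := ⟨(hℓ 0).choose⟩
    rw [MultiEoP.ketBra_ghz]
    -- Pure and mixed cases are treated together, through the coherence `c` of the state on `S`.
    obtain ⟨c, hc, hρ, h1, h2⟩ : ∃ c : ℂ, (c = 1 / 2 ∨ c = 0) ∧
        MultiEoP.reduced S (MultiEoP.ghzMatrix (Fin n) (1 / 2)) =
          MultiEoP.ghzMatrix {i // i ∈ S} c ∧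
        (S = Finset.univ → c = 1 / 2) ∧ (S ≠ Finset.univ → c = 0) := by
      by_cases hS : S = Finset.univ
      · subst hS
        exact ⟨1 / 2, Or.inl rfl, MultiEoP.reduced_ghzMatrix_univ _, fun _ => rfl,
          fun h => absurd rfl h⟩
      · exact ⟨0, Or.inr rfl, MultiEoP.reduced_ghzMatrix hS _, fun h => absurd h hS,
          fun _ => rfl⟩
    rw [hρ]
    have h4 : MultiEoP.meop ℓ (MultiEoP.ghzMatrix {i // i ∈ S} c) = 4 * Real.log 2 := by
      simpa using MultiEoP.meop_ghzMatrix hℓ hc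
    rw [MultiEoP.delta4_ghzMatrix hℓ hc, h4]
    refine ⟨MultiEoP.delta4Condition_ghzMatrix hℓ c, fun k g hk hg => ?_, by ring, ?_, ?_,
      by linarith, ?_⟩
    · have := Fin.nontrivial_iff_two_le.2 hk
      exact MultiEoP.isLeast_meop_ghzMatrix (hg.comp hℓ) hc
    · intro hS
      rw [h1 hS, MultiEoP.shannonEntropy_ghzMatrix_half]
    · intro hS
      rw [h2 hS, MultiEoP.shannonEntropy_ghzMatrix_zero]
    · rcases hc with rfl | rfl
      · rw [MultiEoP.shannonEntropy_ghzMatrix_half]; linarith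
      · rw [MultiEoP.shannonEntropy_ghzMatrix_zero]; linarith
  · rintro ℓ hℓ ρ rfl
    have : Nonempty (Fin n) := ⟨(hℓ 0).choose⟩
    have h4 : MultiEoP.meop ℓ (MultiEoP.ghzMatrix (Fin n) (1 / 2)) = 4 * Real.log 2 := by
      simpa using MultiEoP.meop_ghzMatrix hℓ (Or.inl rfl)
    rw [MultiEoP.ketBra_ghz, MultiEoP.delta4_ghzMatrix hℓ (Or.inl rfl), h4,
      MultiEoP.shannonEntropy_ghzMatrix_half]
    refine ⟨MultiEoP.delta4Condition_ghzMatrix hℓ _, fun k g hk hg => ?_, by ring, by ring⟩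
    have := Fin.nontrivial_iff_two_le.2 hk
    exact MultiEoP.isLeast_meop_ghzMatrix (hg.comp hℓ) (Or.inl rfl)
  · intro _ ℓ hℓ
    rw [MultiEoP.ketBra_ghz]
    exact MultiEoP.delta3_ghzMatrix hℓ (Or.inl rfl)
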